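/- Call a Noetherian local ring Gorenstein if it has finite injective dimension as a module over itself, and call an ideal $J$ of a Gorenstein local ring $R$ a Gorenstein ideal if the factor ring $R/J$ is a Gorenstein local ring. Let $R$ be a commutative Gorenstein local ring, and let $I$ be an ideal of $R$ which is not nilpotent (that is, $I^m\neq 0$ for every $m\geq 1$) and satisfies $\dim R/I=\dim R$ (Krull dimensions). Then there is an integer $N$ such that for every $n\geq N$ the ideal $I^n$ is not a Gorenstein ideal. -/

import Mathlib

/-- A commutative ring `R` is a Gorenstein local ring if it is a Noetherian local ring which has
finite injective dimension as a module over itself. -/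
class IsGorensteinLocalRing (R : Type*) [CommRing R] : Prop
    extends IsNoetherianRing R, IsLocalRing R where
  injectiveDimension_ne_top :
    CategoryTheory.injectiveDimension (ModuleCat.of R R) ≠ ⊤

/-- An ideal `I` of a (Gorenstein local) ring `R` is a Gorenstein ideal if the factor ring `R ⧸ I`
is a Gorenstein local ring. In particular a Gorenstein ideal of `R` is a proper ideal. -/
def IsGorensteinIdeal {R : Type*} [CommRing R] (I : Ideal R) : Prop :=
  IsGorensteinLocalRing (R ⧸ I)

section

open CategoryTheory Abelian IsLocalRing RingTheory.Sequence

universe u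

variable {R : Type u} [CommRing R]

/-! If `R ⧸ J` is Gorenstein of dimension `dim R`, it is a maximal Cohen-Macaulay `R`-module, so
`Ext^i(R ⧸ J, R) = 0` for `i > 0`. Such modules are reflexive, and `Hom(R ⧸ J, R)` is `ann J`,
whence `ann (ann J) = J` (`IsGorensteinIdeal.annihilator_annihilator`). The ideals `ann (I ^ n)`
increase with `n`, hence stabilize. So all Gorenstein powers of large exponent equal one and the
same double annihilator. Two of them with different exponents coincide, and Nakayama makes `I`
nilpotent. -/

lemma LinearMap.shortExact_shortComplex {M₁ M₂ M₃ : Type u} [AddCommGroup M₁] [AddCommGroup M₂]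
    [AddCommGroup M₃] [Module R M₁] [Module R M₂] [Module R M₃] {f : M₁ →ₗ[R] M₂}
    {g : M₂ →ₗ[R] M₃} (hf : Function.Injective f) (hg : Function.Surjective g)
    (h : Function.Exact f g) :
    (ModuleCat.shortComplexOfCompEqZero f g h.linearMap_comp_eq_zero).ShortExact where
  exact := ModuleCat.shortComplex_exact _ h
  mono_f := (ModuleCat.mono_iff_injective _).mpr hf
  epi_g := (ModuleCat.epi_iff_surjective _).mpr hg

/-! ### Vanishing of Ext in the first variable -/

namespace CategoryTheory.ShortComplex.ShortExact

variable {S : ShortComplex (ModuleCat.{u} R)} (hS : S.ShortExact) {N : ModuleCat.{u} R}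
include hS

lemma subsingleton_ext_X₂ {n : ℕ} (h₁ : Subsingleton (Ext S.X₁ N n))
    (h₃ : Subsingleton (Ext S.X₃ N n)) : Subsingleton (Ext S.X₂ N n) := by
  refine subsingleton_of_forall_eq 0 fun x ↦ ?_
  obtain ⟨y, rfl⟩ := Ext.contravariant_sequence_exact₂ hS N x (Subsingleton.elim _ _)
  rw [Subsingleton.elim y 0, Ext.comp_zero]

lemma subsingleton_ext_X₃ {n : ℕ} (h₁ : Subsingleton (Ext S.X₁ N n))
    (h₂ : Subsingleton (Ext S.X₂ N (n + 1))) : Subsingleton (Ext S.X₃ N (n + 1)) := by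
  refine subsingleton_of_forall_eq 0 fun x ↦ ?_
  obtain ⟨y, rfl⟩ := Ext.contravariant_sequence_exact₃ hS N x (Subsingleton.elim _ _)
    (add_comm 1 n)
  rw [Subsingleton.elim y 0, Ext.comp_zero]

lemma subsingleton_ext_X₁ {n : ℕ} (h₂ : Subsingleton (Ext S.X₂ N n))
    (h₃ : Subsingleton (Ext S.X₃ N (n + 1))) : Subsingleton (Ext S.X₁ N n) := by
  refine subsingleton_of_forall_eq 0 fun x ↦ ?_
  obtain ⟨y, rfl⟩ := Ext.contravariant_sequence_exact₁ hS N x (add_comm 1 n)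
    (Subsingleton.elim _ _)
  rw [Subsingleton.elim y 0, Ext.comp_zero]

end CategoryTheory.ShortComplex.ShortExact

/-- Only `Ext^(n-1)` of the kernel matters; quantifying over `i < n` makes `n = 0` (left exactness
of Hom) a uniform case. -/
lemma subsingleton_ext_of_surjective {M N L : ModuleCat.{u} R} {f : M →ₗ[R] N}
    (hf : Function.Surjective f) {n : ℕ}
    (hker : ∀ i < n, Subsingleton (Ext (ModuleCat.of R (LinearMap.ker f)) L i))
    (h : Subsingleton (Ext M L n)) : Subsingleton (Ext N L n) := by
  cases n with
  | zero =>
    refine subsingleton_of_forall_eq 0 fun x ↦ ?_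
    have : Epi (ModuleCat.ofHom f) := (ModuleCat.epi_iff_surjective _).mpr hf
    exact Ext.precomp_mk₀_injective_of_epi L (ModuleCat.ofHom f) (h.elim _ _)
  | succ n =>
    exact (LinearMap.shortExact_shortComplexKer hf).subsingleton_ext_X₃ (hker n (by simp)) h

/-- By the long exact sequence, `x` acts surjectively on the finite module `Ext M N n`, so Nakayama
applies. -/
lemma subsingleton_ext_of_quotSMulTop [IsLocalRing R] [IsNoetherianRing R] {M N : ModuleCat.{u} R}
    [Module.Finite R M] [Module.Finite R N] {x : R} (hx : x ∈ maximalIdeal R)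
    (reg : IsSMulRegular M x) {n : ℕ}
    (h : Subsingleton (Ext (ModuleCat.of R (QuotSMulTop x M)) N (n + 1))) :
    Subsingleton (Ext M N n) := by
  have hcomp (z : Ext M N n) : (Ext.mk₀ (x • 𝟙 M)).comp z (zero_add n) = x • z := by
    rw [Ext.mk₀_smul, Ext.smul_comp, Ext.mk₀_id_comp]
  have hsurj (y : Ext M N n) : ∃ z : Ext M N n, x • z = y := by
    obtain ⟨z, hz⟩ := Ext.contravariant_sequence_exact₁ reg.smulShortComplex_shortExact N y
      (add_comm 1 n) (h.elim _ _)
    exact ⟨z, (hcomp z).symm.trans hz⟩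
  by_contra! ntr
  have : x ∈ (Module.annihilator R (Ext M N n)).jacobson :=
    (IsLocalRing.maximalIdeal_le_jacobson _) hx
  refine Submodule.top_ne_pointwise_smul_of_mem_jacobson_annihilator this (eq_comm.mp ?_)
  rw [eq_top_iff]
  intro y _
  obtain ⟨z, rfl⟩ := hsurj y
  exact Submodule.smul_mem_pointwise_smul z x ⊤ trivial

lemma subsingleton_ext_of_isRegular [IsLocalRing R] [IsNoetherianRing R] {N : ModuleCat.{u} R}
    [Module.Finite R N] {r : ℕ}
    (hN : ∀ M : ModuleCat.{u} R, Module.Finite R M → ∀ i, r < i → Subsingleton (Ext M N i))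
    (M : ModuleCat.{u} R) [Module.Finite R M] {xs : List R} (hxs : ∀ x ∈ xs, x ∈ maximalIdeal R)
    (reg : IsWeaklyRegular M xs) {i : ℕ} (hi : r < i + xs.length) : Subsingleton (Ext M N i) := by
  induction xs generalizing M i with
  | nil => exact hN M inferInstance i hi
  | cons x xs ih =>
    rw [isWeaklyRegular_cons_iff] at reg
    simp only [List.mem_cons, forall_eq_or_imp, List.length_cons] at hxs hi
    exact subsingleton_ext_of_quotSMulTop hxs.1 reg.1
      (ih (ModuleCat.of R (QuotSMulTop x M)) hxs.2 reg.2 (by omega))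

lemma subsingleton_ext_congr {M M' : ModuleCat.{u} R} (N : ModuleCat.{u} R) (e : M ≃ₗ[R] M')
    {n : ℕ} (h : Subsingleton (Ext M' N n)) : Subsingleton (Ext M N n) := by
  refine subsingleton_of_forall_eq 0 fun x ↦ ?_
  have : x = (Ext.mk₀ e.toModuleIso.hom).comp
      ((Ext.mk₀ e.toModuleIso.inv).comp x (zero_add n)) (zero_add n) := by
    rw [Ext.mk₀_comp_mk₀_assoc, Iso.hom_inv_id, Ext.mk₀_id_comp]
  rw [this, h.elim ((Ext.mk₀ e.toModuleIso.inv).comp x (zero_add n)) 0, Ext.comp_zero]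

section

variable [IsLocalRing R] [IsNoetherianRing R]

lemma subsingleton_ext_quotient_prime {N : ModuleCat.{u} R} [Module.Finite R N] {r : ℕ}
    (hN : ∀ M : ModuleCat.{u} R, Module.Finite R M → Subsingleton (Ext M N (r + 1)))
    (p : Ideal R) [hp : p.IsPrime] (hpm : p ≠ maximalIdeal R) :
    Subsingleton (Ext (ModuleCat.of R (R ⧸ p)) N r) := by
  obtain ⟨x, hx, hxp⟩ := SetLike.exists_of_lt ((le_maximalIdeal hp.ne_top).lt_of_ne hpm)
  refine subsingleton_ext_of_quotSMulTop hx ?_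
    (hN (ModuleCat.of R (QuotSMulTop x (R ⧸ p))) inferInstance)
  refine isSMulRegular_iff_right_eq_zero_of_smul.mpr fun y hy ↦ ?_
  rw [Algebra.smul_def] at hy
  exact (mul_eq_zero.mp hy).resolve_left fun h ↦ hxp (Ideal.Quotient.eq_zero_iff_mem.mp h)

/-- Dévissage along a prime filtration: a non-maximal prime is handled by an element of the maximal
ideal outside it, which leaves only the residue field. -/
lemma subsingleton_ext_of_residue {N : ModuleCat.{u} R} [Module.Finite R N] {r : ℕ}
    (hN : ∀ M : ModuleCat.{u} R, Module.Finite R M → Subsingleton (Ext M N (r + 1)))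
    (hk : Subsingleton (Ext (ModuleCat.of R (R ⧸ maximalIdeal R)) N r))
    (M : ModuleCat.{u} R) [hM : Module.Finite R M] : Subsingleton (Ext M N r) := by
  refine IsNoetherianRing.induction_on_isQuotientEquivQuotientPrime R hM
    (motive := fun M _ _ _ ↦ Subsingleton (Ext (ModuleCat.of R M) N r)) ?_ ?_ ?_
  · intro M _ _ _ _
    refine subsingleton_of_forall_eq 0 fun x ↦ ?_
    rw [← x.mk₀_id_comp, (ModuleCat.isZero_of_subsingleton (ModuleCat.of R M)).eq_zero_of_src (𝟙 _),
      Ext.mk₀_zero, Ext.zero_comp]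
  · intro M _ _ _ p e
    refine subsingleton_ext_congr N (M' := ModuleCat.of R (R ⧸ p.1)) e ?_
    by_cases hp : p.1 = maximalIdeal R
    · rw [hp]; exact hk
    · exact subsingleton_ext_quotient_prime hN p.1 hp
  · intro M₁ _ _ _ M₂ _ _ _ M₃ _ _ _ f g hf hg hfg h₁ h₃
    exact (LinearMap.shortExact_shortComplex hf hg hfg).subsingleton_ext_X₂ h₁ h₃

end

/-! ### Self-injective dimension, depth and Krull dimension -/

/-- A Noetherian local ring of finite self-injective dimension is Cohen-Macaulay, and its
injective dimension is at most its Krull dimension. -/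
theorem exists_isRegular_of_hasInjectiveDimensionLE [IsLocalRing R] [IsNoetherianRing R] {n : ℕ}
    (h : HasInjectiveDimensionLE (ModuleCat.of R R) n) :
    ∃ xs : List R, (∀ x ∈ xs, x ∈ maximalIdeal R) ∧ IsRegular R xs ∧
      ringKrullDim R = xs.length ∧ ∀ M : ModuleCat.{u} R, Module.Finite R M →
        ∀ i, xs.length < i → Subsingleton (Ext M (ModuleCat.of R R) i) := by
  classical
  have hex : ∃ r : ℕ, ∀ M : ModuleCat.{u} R, Module.Finite R M →
      ∀ i, r < i → Subsingleton (Ext M (ModuleCat.of R R) i) :=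
    ⟨n, fun M _ i hi ↦ HasInjectiveDimensionLT.subsingleton _ (n + 1) i hi M⟩
  obtain ⟨r, hr, hmin⟩ : ∃ r : ℕ, (∀ M : ModuleCat.{u} R, Module.Finite R M →
      ∀ i, r < i → Subsingleton (Ext M (ModuleCat.of R R) i)) ∧ ∀ s < r,
        ¬ ∀ M : ModuleCat.{u} R, Module.Finite R M →
          ∀ i, s < i → Subsingleton (Ext M (ModuleCat.of R R) i) :=
    ⟨Nat.find hex, Nat.find_spec hex, fun s hs ↦ Nat.find_min hex hs⟩
  have hr1 (M : ModuleCat.{u} R) (_ : Module.Finite R M) :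
      Subsingleton (Ext M (ModuleCat.of R R) (r + 1)) := hr M inferInstance _ (by simp)
  let k := ModuleCat.of R (R ⧸ maximalIdeal R)
  have hk : ¬ Subsingleton (Ext k (ModuleCat.of R R) r) := by
    intro hk
    have hall (M : ModuleCat.{u} R) (_ : Module.Finite R M) :
        Subsingleton (Ext M (ModuleCat.of R R) r) := subsingleton_ext_of_residue hr1 hk M
    cases r with
    | zero =>
      have := (Ext.addEquiv₀.trans ModuleCat.homAddEquiv).symm.subsingleton_congr.mpr
        (hall (ModuleCat.of R R) inferInstance)
      exact one_ne_zero (α := R)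
        (LinearMap.congr_fun (this.elim (LinearMap.id : R →ₗ[R] R) 0) 1)
    | succ r =>
      refine hmin r (by simp) fun M _ i hi ↦ ?_
      obtain rfl | hi := (Nat.succ_le_of_lt hi).eq_or_lt
      · exact hall M inferInstance
      · exact hr M inferInstance i hi
  have hexk : ∃ i, ¬ Subsingleton (Ext k (ModuleCat.of R R) i) := ⟨r, hk⟩
  obtain ⟨t, ht, htmin⟩ : ∃ t, ¬ Subsingleton (Ext k (ModuleCat.of R R) t) ∧
      ∀ i < t, Subsingleton (Ext k (ModuleCat.of R R) i) :=
    ⟨Nat.find hexk, Nat.find_spec hexk, fun i hi ↦ not_not.mp (Nat.find_min hexk hi)⟩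
  have htr : t ≤ r := not_lt.mp fun hlt ↦ hk (htmin r hlt)
  have hann : Module.annihilator R (R ⧸ maximalIdeal R) = maximalIdeal R :=
    Ideal.annihilator_quotient
  have hlt : maximalIdeal R • (⊤ : Submodule R R) < ⊤ := by
    simpa using (Ideal.IsMaximal.ne_top inferInstance : maximalIdeal R ≠ ⊤).lt_top
  have hsupp : Module.support R (R ⧸ maximalIdeal R) =
      PrimeSpectrum.zeroLocus (maximalIdeal R) := by
    rw [Module.support_eq_zeroLocus, hann]
  obtain ⟨xs, rfl, hmem, hreg⟩ := ModuleCat.exists_isRegular_of_exists_subsingleton_ext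
    (maximalIdeal R) t (ModuleCat.of R R) hlt k hsupp htmin
  have hreg' : IsRegular R xs := hreg
  let B := R ⧸ (Ideal.ofList xs • ⊤ : Submodule R R)
  have hnonreg : ¬ Subsingleton ((R ⧸ maximalIdeal R) →ₗ[R] B) := by
    rw [IsSMulRegular.subsingleton_linearMap_iff, hann]
    rintro ⟨y, hy, hyB⟩
    have hmem' : ∀ x ∈ xs ++ [y], x ∈ maximalIdeal R := by
      intro x hx
      rcases List.mem_append.mp hx with hx | hx
      · exact hmem x hx
      · rwa [List.mem_singleton.mp hx]
    have hreg'' : IsRegular R (xs ++ [y]) :=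
      .of_isWeaklyRegular_of_mem_maximalIdeal R hmem' <| (isWeaklyRegular_append_iff R xs [y]).mpr
        ⟨hreg'.1, (isWeaklyRegular_singleton_iff _ y).mpr hyB⟩
    exact ht (ModuleCat.subsingleton_ext_of_exists_isRegular (maximalIdeal R) k hsupp.subset
      (ModuleCat.of R R) hlt (xs ++ [y]) hmem' hreg'' xs.length (by simp))
  -- The residue field embeds in `B`, whose projective dimension is at most `xs.length`. If `r` were
  -- larger, `Ext^r(k, R)` would sit between `Ext^r(B, R) = 0` and `Ext^(r+1)(B/k, R) = 0`.
  have hrt : r ≤ xs.length := by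
    by_contra! hlt'
    rw [not_subsingleton_iff_nontrivial] at hnonreg
    obtain ⟨f, hf⟩ := exists_ne (0 : (R ⧸ maximalIdeal R) →ₗ[R] B)
    have : IsSimpleModule R (R ⧸ maximalIdeal R) :=
      isSimpleModule_iff_isCoatom.mpr (Ideal.IsMaximal.out)
    have hpd : projectiveDimension (ModuleCat.of R B) ≤ xs.length := by
      have := ModuleCat.projectiveDimension_quotient_eq_add_length_of_isWeaklyRegular
        (ModuleCat.of R R) xs hreg'.1 hmem
      rw [show projectiveDimension (ModuleCat.of R R) = 0 from
        ModuleCat.projectiveDimension_eq_zero_of_projective _, zero_add] at this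
      exact this.le
    rw [projectiveDimension_le_iff] at hpd
    refine hk ((LinearMap.shortExact_shortComplex (LinearMap.injective_of_ne_zero hf)
      (Submodule.mkQ_surjective (LinearMap.range f)) ?_).subsingleton_ext_X₁
        (N := ModuleCat.of R R) ?_ ?_)
    · exact LinearMap.exact_map_mkQ_range f
    · exact HasProjectiveDimensionLT.subsingleton _ (xs.length + 1) r hlt' _
    · exact hr1 (ModuleCat.of R (B ⧸ LinearMap.range f)) inferInstance
  obtain rfl : r = xs.length := le_antisymm hrt htr
  have hlt'' : Ideal.ofList xs • (⊤ : Submodule R R) < ⊤ := hreg'.2.symm.lt_top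
  -- The kernel of `R ⧸ p → k` is supported on `V(xs)`, so its Ext groups vanish below `r`. Hence
  -- `Ext^r(k, R)` embeds in `Ext^r(R ⧸ p, R)`, which is zero if `p` is not maximal.
  have hprime (p : Ideal R) [hp : p.IsPrime] (hle : Ideal.ofList xs ≤ p) : p = maximalIdeal R := by
    by_contra hpm
    have hpm' := le_maximalIdeal hp.ne_top
    let g : (R ⧸ p) →ₗ[R] (R ⧸ maximalIdeal R) := Submodule.factor hpm'
    refine hk (subsingleton_ext_of_surjective (f := g) (M := ModuleCat.of R (R ⧸ p)) (N := k)
      (Submodule.factor_surjective hpm') ?_ (subsingleton_ext_quotient_prime hr1 p hpm))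
    refine ModuleCat.subsingleton_ext_of_exists_isRegular (Ideal.ofList xs) _ ?_ _ hlt'' xs
      (fun x hx ↦ Ideal.subset_span hx) hreg
    refine (Module.support_subset_of_injective (LinearMap.ker g).subtype
      (Submodule.injective_subtype _)).trans ?_
    rw [Module.support_eq_zeroLocus, Ideal.annihilator_quotient]
    exact PrimeSpectrum.zeroLocus_anti_mono hle
  refine ⟨xs, hmem, hreg', ?_, hr⟩
  rw [← ringKrullDim_add_length_eq_ringKrullDim_of_isRegular xs hreg']
  have hsub : Subsingleton (PrimeSpectrum.zeroLocus (R := R) (Ideal.ofList xs)) :=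
    ⟨fun a b ↦ Subtype.ext (PrimeSpectrum.ext
      ((hprime a.1.1 a.2).trans (hprime b.1.1 b.2).symm))⟩
  have hne : Nonempty (PrimeSpectrum.zeroLocus (R := R) (Ideal.ofList xs)) :=
    ⟨⟨⟨maximalIdeal R, inferInstance⟩, Ideal.span_le.mpr hmem⟩⟩
  rw [ringKrullDim_quotient, Order.krullDim_eq_zero, zero_add]

/-! ### Duality and reflexivity of acyclic modules -/

/-- `M` is acyclic for the functor `Hom(-, R)`. -/
def IsDualAcyclic (M : ModuleCat.{u} R) : Prop :=
  ∀ i, Subsingleton (Ext M (ModuleCat.of R R) (i + 1))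

lemma IsDualAcyclic.of_projective (M : ModuleCat.{u} R) [Projective M] : IsDualAcyclic M :=
  fun i ↦ Ext.subsingleton_of_projective M _ i

lemma exists_dual_extension {S : ShortComplex (ModuleCat.{u} R)} (hS : S.ShortExact)
    (h : Subsingleton (Ext S.X₃ (ModuleCat.of R R) 1)) (φ : S.X₁ →ₗ[R] R) :
    ∃ ψ : S.X₂ →ₗ[R] R, ψ ∘ₗ S.f.hom = φ := by
  obtain ⟨x, hx⟩ := Ext.contravariant_sequence_exact₁ hS (ModuleCat.of R R)
    (Ext.mk₀ (ModuleCat.ofHom φ)) (add_comm 1 0) (h.elim _ _)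
  obtain ⟨ψ, rfl⟩ := (Ext.mk₀_bijective _ _).2 x
  rw [Ext.mk₀_comp_mk₀, (Ext.mk₀_bijective _ _).1.eq_iff] at hx
  exact ⟨ψ.hom, congrArg ModuleCat.Hom.hom hx⟩

section

variable {M F : Type u} [AddCommGroup M] [Module R M] [AddCommGroup F] [Module R F]
  {f : F →ₗ[R] M} (hf : Function.Surjective f)
include hf

lemma IsDualAcyclic.ker [Module.Free R F] (hM : IsDualAcyclic (ModuleCat.of R M)) :
    IsDualAcyclic (ModuleCat.of R (LinearMap.ker f)) := fun i ↦
  (LinearMap.shortExact_shortComplexKer hf).subsingleton_ext_X₁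
    (IsDualAcyclic.of_projective (ModuleCat.of R F) i) (hM (i + 1))

lemma IsDualAcyclic.dualMap_subtype_surjective (hM : IsDualAcyclic (ModuleCat.of R M)) :
    Function.Surjective (LinearMap.ker f).subtype.dualMap := fun φ ↦
  exists_dual_extension (LinearMap.shortExact_shortComplexKer hf) (hM 0) φ

lemma exact_dualMap_dualMap_subtype :
    Function.Exact f.dualMap (LinearMap.ker f).subtype.dualMap := by
  intro φ
  constructor
  · intro h
    refine ⟨(LinearMap.ker f).liftQ φ (fun x hx ↦ LinearMap.congr_fun h ⟨x, hx⟩) ∘ₗ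
      (f.quotKerEquivOfSurjective hf).symm, ?_⟩
    ext x
    have : (f.quotKerEquivOfSurjective hf).symm (f x) = (LinearMap.ker f).mkQ x := by
      rw [LinearEquiv.symm_apply_eq]; rfl
    simp only [LinearMap.dualMap_apply, LinearMap.comp_apply, LinearEquiv.coe_coe, this]
    rfl
  · rintro ⟨ψ, rfl⟩
    ext x
    simp

end

/-- Over a ring of finite self-injective dimension, the dual of an acyclic finite module is
acyclic. -/
lemma IsDualAcyclic.dual [IsNoetherianRing R] {r : ℕ}
    (hr : ∀ M : ModuleCat.{u} R, Module.Finite R M →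
      ∀ i, r < i → Subsingleton (Ext M (ModuleCat.of R R) i))
    {M : Type u} [AddCommGroup M] [Module R M] [Module.Finite R M]
    (hM : IsDualAcyclic (ModuleCat.of R M)) : IsDualAcyclic (ModuleCat.of R (Module.Dual R M)) := by
  -- Dualizing `0 → K → F → M → 0` stays exact, so passing to the syzygy `K` raises the Ext index by
  -- one; after `n` steps it exceeds `r`.
  have key (n : ℕ) (M : Type u) [AddCommGroup M] [Module R M] [Module.Finite R M]
      (hM : IsDualAcyclic (ModuleCat.of R M)) (i : ℕ) (hi : r < i + n + 1) :
      Subsingleton (Ext (ModuleCat.of R (Module.Dual R M)) (ModuleCat.of R R) (i + 1)) := by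
    induction n generalizing M i with
    | zero => exact hr _ inferInstance _ hi
    | succ n ih =>
      obtain ⟨F, _, _, _, _, f, hf⟩ := Module.exists_finite_presentation R M
      have := ih (LinearMap.ker f) (hM.ker hf) (i + 1) (by omega)
      exact (LinearMap.shortExact_shortComplex (LinearMap.dualMap_injective_of_surjective hf)
        (hM.dualMap_subtype_surjective hf) (exact_dualMap_dualMap_subtype hf)).subsingleton_ext_X₁
          (IsDualAcyclic.of_projective (ModuleCat.of R (Module.Dual R F)) i) this
  exact fun i ↦ key r M hM i (by omega)

/-- Since the dual of the syzygy is acyclic, a functional on `M*` extends to `F*`, where it is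
evaluation at a point. -/
lemma IsDualAcyclic.eval_surjective [IsNoetherianRing R] {r : ℕ}
    (hr : ∀ M : ModuleCat.{u} R, Module.Finite R M →
      ∀ i, r < i → Subsingleton (Ext M (ModuleCat.of R R) i))
    {M : Type u} [AddCommGroup M] [Module R M] [Module.Finite R M]
    (hM : IsDualAcyclic (ModuleCat.of R M)) : Function.Surjective (Module.Dual.eval R M) := by
  obtain ⟨F, _, _, _, _, f, hf⟩ := Module.exists_finite_presentation R M
  intro φ
  obtain ⟨ψ, hψ⟩ := exists_dual_extension
    (LinearMap.shortExact_shortComplex (LinearMap.dualMap_injective_of_surjective hf)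
      (hM.dualMap_subtype_surjective hf) (exact_dualMap_dualMap_subtype hf))
    ((hM.ker hf).dual hr 0) φ
  obtain ⟨x, rfl⟩ := (Module.evalEquiv R F).surjective ψ
  exact ⟨f x, hψ⟩

/-- If evaluation at `f x` is zero, evaluation at `x` factors through the dual of `ker f`. By
surjectivity there, it is evaluation at some `y` in `ker f`, and `x = y` because `F` is reflexive.
-/
lemma IsDualAcyclic.eval_injective [IsNoetherianRing R] {r : ℕ}
    (hr : ∀ M : ModuleCat.{u} R, Module.Finite R M →
      ∀ i, r < i → Subsingleton (Ext M (ModuleCat.of R R) i))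
    {M : Type u} [AddCommGroup M] [Module R M] [Module.Finite R M]
    (hM : IsDualAcyclic (ModuleCat.of R M)) : Function.Injective (Module.Dual.eval R M) := by
  obtain ⟨F, _, _, _, _, f, hf⟩ := Module.exists_finite_presentation R M
  rw [injective_iff_map_eq_zero]
  intro m hm
  obtain ⟨x, rfl⟩ := hf m
  let e := (LinearMap.ker f).subtype.dualMap.quotKerEquivOfSurjective
    (hM.dualMap_subtype_surjective hf)
  have hker : LinearMap.ker (LinearMap.ker f).subtype.dualMap ≤
      LinearMap.ker (Module.Dual.eval R F x) := by
    intro φ hφ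
    obtain ⟨ψ, rfl⟩ := (exact_dualMap_dualMap_subtype hf φ).mp hφ
    exact LinearMap.congr_fun hm ψ
  obtain ⟨y, hy⟩ := (hM.ker hf).eval_surjective hr
    (Submodule.liftQ _ (Module.Dual.eval R F x) hker ∘ₗ e.symm)
  have hxy : x = y := by
    refine (Module.evalEquiv R F).injective (LinearMap.ext fun φ ↦ ?_)
    have h1 : e.symm ((LinearMap.ker f).subtype.dualMap φ) = Submodule.Quotient.mk φ := by
      rw [LinearEquiv.symm_apply_eq]; rfl
    have h2 := LinearMap.congr_fun hy ((LinearMap.ker f).subtype.dualMap φ)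
    rw [LinearMap.comp_apply, LinearEquiv.coe_coe, h1] at h2
    exact h2.symm
  rw [hxy]
  exact y.2

lemma annihilator_annihilator_of_isDualAcyclic [IsNoetherianRing R] {r : ℕ}
    (hr : ∀ M : ModuleCat.{u} R, Module.Finite R M →
      ∀ i, r < i → Subsingleton (Ext M (ModuleCat.of R R) i))
    {J : Ideal R} (hJ : IsDualAcyclic (ModuleCat.of R (R ⧸ J))) :
    Submodule.annihilator (Submodule.annihilator J) = J := by
  refine le_antisymm (fun a ha ↦ ?_) (fun a ha ↦ ?_)
  · refine Ideal.Quotient.eq_zero_iff_mem.mp (hJ.eval_injective hr ?_)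
    rw [map_zero]
    ext φ
    -- A functional on `R ⧸ J` is multiplication by `φ 1`, so every functional kills the class of
    -- `a`.
    have hb : φ 1 ∈ Submodule.annihilator J := Submodule.mem_annihilator.mpr fun c hc ↦ by
      rw [smul_eq_mul, mul_comm, ← smul_eq_mul, ← map_smul, Algebra.smul_def, mul_one]
      exact (congrArg φ (Ideal.Quotient.eq_zero_iff_mem.mpr hc)).trans (map_zero φ)
    have h := Submodule.mem_annihilator.mp ha _ hb
    rw [← map_smul, Algebra.smul_def, mul_one] at h
    exact h
  · refine Submodule.mem_annihilator.mpr fun b hb ↦ ?_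
    rw [smul_eq_mul, mul_comm]
    exact Submodule.mem_annihilator.mp hb a ha

/-! ### Gorenstein ideals and their powers -/

lemma exists_isRegular_of_isGorensteinLocalRing [h : IsGorensteinLocalRing R] :
    ∃ xs : List R, (∀ x ∈ xs, x ∈ maximalIdeal R) ∧ IsRegular R xs ∧
      ringKrullDim R = xs.length ∧ ∀ M : ModuleCat.{u} R, Module.Finite R M →
        ∀ i, xs.length < i → Subsingleton (Ext M (ModuleCat.of R R) i) := by
  obtain ⟨n, hn⟩ := (injectiveDimension_ne_top_iff _).mp h.injectiveDimension_ne_top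
  exact exists_isRegular_of_hasInjectiveDimensionLE hn

theorem IsGorensteinIdeal.annihilator_annihilator [IsGorensteinLocalRing R] {J : Ideal R}
    (hJ : IsGorensteinIdeal J) (hdim : ringKrullDim (R ⧸ J) = ringKrullDim R) :
    Submodule.annihilator (Submodule.annihilator J) = J := by
  have : IsGorensteinLocalRing (R ⧸ J) := hJ
  obtain ⟨xs, -, -, hxdim, hr⟩ := exists_isRegular_of_isGorensteinLocalRing (R := R)
  obtain ⟨ys, hys, hyreg, hydim, -⟩ := exists_isRegular_of_isGorensteinLocalRing (R := R ⧸ J)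
  have hlen : ys.length = xs.length := by
    rw [hxdim, hydim] at hdim
    exact_mod_cast hdim
  obtain ⟨zs, rfl⟩ := List.map_surjective_iff.mpr (Ideal.Quotient.mk_surjective (I := J)) ys
  rw [List.length_map] at hlen
  -- Each element of the lifted regular sequence lowers the vanishing bound by one, and there are
  -- `dim R` of them, so every positive Ext vanishes.
  refine annihilator_annihilator_of_isDualAcyclic hr fun i ↦
    subsingleton_ext_of_isRegular hr (ModuleCat.of R (R ⧸ J)) (xs := zs) (fun z hz ↦ ?_)
      ((isWeaklyRegular_map_algebraMap_iff (R ⧸ J) (R ⧸ J) zs).mp hyreg.1) (by omega)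
  have := hys _ (List.mem_map_of_mem hz)
  rw [mem_maximalIdeal, mem_nonunits_iff] at this ⊢
  exact fun hu ↦ this (hu.map _)

lemma ringKrullDim_quotient_pow (I : Ideal R) {n : ℕ} (hn : n ≠ 0) :
    ringKrullDim (R ⧸ I ^ n) = ringKrullDim (R ⧸ I) := by
  rw [ringKrullDim_quotient, ringKrullDim_quotient, PrimeSpectrum.zeroLocus_pow I hn]

lemma exists_annihilator_pow_eq [IsNoetherianRing R] (I : Ideal R) :
    ∃ N, ∀ n, N ≤ n → Submodule.annihilator (I ^ N) = Submodule.annihilator (I ^ n) :=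
  monotone_stabilizes_iff_noetherian.mpr ‹_›
    ⟨fun n ↦ Submodule.annihilator (I ^ n),
      fun _ _ h ↦ Submodule.annihilator_mono (Ideal.pow_le_pow_right h)⟩

end

theorem theorem3p8 {R : Type*} [CommRing R] [IsGorensteinLocalRing R] (I : Ideal R)
    (hI : ¬ IsNilpotent I) (hdim : ringKrullDim (R ⧸ I) = ringKrullDim R) :
    ∃ N : ℕ, ∀ n : ℕ, N ≤ n → ¬ IsGorensteinIdeal (I ^ n) := by
  obtain ⟨N, hN⟩ := exists_annihilator_pow_eq I
  by_contra! hG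
  -- Starting at `N + 1` keeps the exponent nonzero, as needed for `dim R ⧸ I ^ n = dim R ⧸ I`.
  obtain ⟨n, hn, hGn⟩ := hG (N + 1)
  obtain ⟨m, hm, hGm⟩ := hG (n + 1)
  -- The zero ring has dimension `⊥`, so the dimension hypothesis makes `I` proper.
  have hIm : I ≤ IsLocalRing.maximalIdeal R := by
    refine IsLocalRing.le_maximalIdeal fun h ↦ ?_
    have : Subsingleton (R ⧸ I) := Ideal.Quotient.subsingleton_iff.mpr h
    have hnonneg := ringKrullDim_nonneg_of_nontrivial (R := R)
    rw [← hdim, ringKrullDim_eq_bot_of_subsingleton] at hnonneg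
    simp at hnonneg
  have hdd (k : ℕ) (hk : N + 1 ≤ k) (h : IsGorensteinIdeal (I ^ k)) :
      I ^ k = Submodule.annihilator (Submodule.annihilator (I ^ N)) := by
    rw [hN k (by omega)]
    exact (h.annihilator_annihilator
      ((ringKrullDim_quotient_pow I (by omega)).trans hdim)).symm
  have hnm : I ^ n = I ^ m := (hdd n hn hGn).trans (hdd m (by omega) hGm).symm
  refine hI ⟨n, Submodule.eq_bot_of_le_smul_of_le_jacobson_bot I (I ^ n)
    (IsNoetherian.noetherian _) ?_ (hIm.trans (IsLocalRing.jacobson_eq_maximalIdeal ⊥ bot_ne_top).ge)⟩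
  rw [smul_eq_mul, ← pow_succ']
  exact hnm.le.trans (Ideal.pow_le_pow_right hm)
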